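/- Let $p$ be a prime, let $C$ be an $[n,k]$ linear code over $\mathbb{F}_{p^2}$ (a $k$-dimensional linear subspace of $\mathbb{F}_{p^2}^n$), and let $C^{\perp_h}=\{x\in\mathbb{F}_{p^2}^n : \sum_i x_i c_i^{\,p}=0 \text{ for all } c\in C\}$ be its Hermitian dual. For a linear code $D$ let $\mathrm{wt}(D)$ be the minimum Hamming weight of a nonzero codeword of $D$ (with $\mathrm{wt}(\{0\})=\infty$). Put $e=n-k-\dim(C\cap C^{\perp_h})$; this is a nonnegative integer, and $2k-n+e\ge 0$. Then there is a quantum code with parameters $[[n+e,\,2k-n+e,\,d]]_p$ with $$d\ \ge\ \min\bigl(\mathrm{wt}(C),\ \mathrm{wt}(C+C^{\perp_h})+1\bigr).$$ Moreover, if $2k\ge n$, there is also a quantum code with parameters $[[n+e,\,2k-n,\,d']]_p$, with the same lower bound for $d'$. Here a quantum code with parameters $[[N,K,d]]_p$ is a stabilizer code of dimension $p^K$ in $(\mathbb{C}^p)^{\otimes N}$, that is, the common $1$-eigenspace $Q$ of a commutative group of operators of the form $cX(a)Z(b)$, with $c\in\mathbb{C}^\ast$, $a,b\in\mathbb{F}_p^N$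 and $X(a)Z(b)|x\rangle=e^{2\pi i\,(b\cdot x)/p}|x+a\rangle$. With $P$ the orthogonal projection onto $Q$, its minimum distance $d$ is the least weight of an error $T=X(a)Z(b)$ for which $PTP$ is not a scalar multiple of $P$ or, when $\dim Q=1$, the least weight of an error $T=X(a)Z(b)$ with $(a,b)\neq(0,0)$ and $PTP\neq 0$. The weight of $X(a)Z(b)$ is the number of $i$ with $(a_i,b_i)\ne(0,0)$, and $d=\infty$ if there is no such error, which happens only for $N=0$. -/

import Mathlib

noncomputable section

/-! ### Linear codes over a field with `p ^ 2` elements -/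

/-- The Hermitian inner product `∑ xᵢ * conj yᵢ` on `Fⁿ`, where `conj y = y ^ p`. -/
def hermInner (p : ℕ) {F : Type*} [Field F] {n : ℕ} (x y : Fin n → F) : F :=
  ∑ i, x i * y i ^ p

/-- The Hermitian dual of a linear code. -/
def hermDual (p : ℕ) {F : Type*} [Field F] {n : ℕ} (C : Submodule F (Fin n → F)) :
    Submodule F (Fin n → F) where
  carrier := {x | ∀ c ∈ C, hermInner p x c = 0}
  zero_mem' := by
    intro c _
    simp [hermInner]
  add_mem' := by
    intro x y hx hy c hc
    have h1 := hx c hc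
    have h2 := hy c hc
    simp only [hermInner] at h1 h2 ⊢
    simp [add_mul, Finset.sum_add_distrib, h1, h2]
  smul_mem' := by
    intro r x hx c hc
    have h1 := hx c hc
    simp only [hermInner] at h1 ⊢
    simp [mul_assoc, ← Finset.mul_sum, h1]

/-- The Hamming weight of a vector. -/
def hammingWt {F : Type*} [Field F] {n : ℕ} (x : Fin n → F) : ℕ :=
  {i | x i ≠ 0}.ncard

/-- The minimum Hamming weight of a nonzero codeword (`⊤` for the zero code). -/
def codeWt {F : Type*} [Field F] {n : ℕ} (C : Submodule F (Fin n → F)) : ℕ∞ :=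
  ⨅ x ∈ {x | x ∈ C ∧ x ≠ 0}, (hammingWt x : ℕ∞)

/-! ### Quantum codes on `N` qudits of dimension `p` -/

/-- The state space `(ℂ^p)^{⊗N}`, with orthonormal computational basis `|x⟩`,
`x ∈ (ℤ/p)^N`. -/
abbrev QuditSpace (p N : ℕ) [NeZero p] : Type :=
  EuclideanSpace ℂ (Fin N → ZMod p)

/-- The error operator `X(a) Z(b)`, sending `|x⟩` to `exp (2πi (b ⬝ x) / p) |x + a⟩`. -/
def errorOp {p N : ℕ} [NeZero p] (a b : Fin N → ZMod p) :
    QuditSpace p N →ₗ[ℂ] QuditSpace p N where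
  toFun ψ := WithLp.toLp 2 fun x => ZMod.stdAddChar (b ⬝ᵥ (x - a)) * ψ (x - a)
  map_add' := by
    intro ψ φ
    ext x
    simp [mul_add]
  map_smul' := by
    intro c ψ
    ext x
    simp [mul_left_comm]

/-- The weight of `X(a) Z(b)`: the number of qudits on which it acts nontrivially. -/
def errorWt {p N : ℕ} (a b : Fin N → ZMod p) : ℕ :=
  {i | a i ≠ 0 ∨ b i ≠ 0}.ncard

/-- The code `Q` detects the error `T`: `P T P = c P` for a scalar `c`, with `P` the orthogonal
projection onto `Q`. -/
def Detects {p N : ℕ} [NeZero p] (Q : Submodule ℂ (QuditSpace p N))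
    (T : QuditSpace p N →ₗ[ℂ] QuditSpace p N) : Prop :=
  ∃ c : ℂ, ∀ φ ∈ Q, ∀ ψ ∈ Q, inner ℂ φ (T ψ) = c * inner ℂ φ ψ

open Classical in
/-- The minimum distance of a quantum code: the least weight of an error that is not detected.
For one-dimensional codes, which detect every error in this sense, the usual convention is
followed: the least weight of an error other than the identity with `P T P ≠ 0`. -/
def quantumDist {p N : ℕ} [NeZero p] (Q : Submodule ℂ (QuditSpace p N)) : ℕ∞ :=
  if Module.finrank ℂ Q = 1 then
    ⨅ v ∈ {v : (Fin N → ZMod p) × (Fin N → ZMod p) |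
      v ≠ 0 ∧ ∃ φ ∈ Q, ∃ ψ ∈ Q, inner ℂ φ (errorOp v.1 v.2 ψ) ≠ 0}, (errorWt v.1 v.2 : ℕ∞)
  else
    ⨅ v ∈ {v : (Fin N → ZMod p) × (Fin N → ZMod p) | ¬ Detects Q (errorOp v.1 v.2)},
      (errorWt v.1 v.2 : ℕ∞)

/-- `Q` is a stabilizer code: the common `1`-eigenspace of a commutative group of operators, each of
which is an error operator `X(a) Z(b)` up to a phase. (If `Q ≠ 0`, the phases are automatically
roots of unity and the group is finite.) -/
def IsStabilizerCode {p N : ℕ} [NeZero p] (Q : Submodule ℂ (QuditSpace p N)) : Prop :=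
  ∃ S : Subgroup (QuditSpace p N →ₗ[ℂ] QuditSpace p N)ˣ,
    (∀ s ∈ S, ∃ (c : ℂ) (a b : Fin N → ZMod p),
      (s : QuditSpace p N →ₗ[ℂ] QuditSpace p N) = c • errorOp a b) ∧
    (∀ s ∈ S, ∀ t ∈ S, s * t = t * s) ∧
    ∀ ψ, ψ ∈ Q ↔ ∀ s ∈ S, (s : QuditSpace p N →ₗ[ℂ] QuditSpace p N) ψ = ψ

/-- `Q` is a quantum code with parameters `[[N, K, d]]_p`: a stabilizer code of dimension `p ^ K`
in `(ℂ^p)^{⊗N}` with minimum distance `d` (which is finite unless `N = 0`). -/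
structure IsQuantumCode {p N : ℕ} [NeZero p] (Q : Submodule ℂ (QuditSpace p N))
    (K : ℕ) (d : ℕ∞) : Prop where
  stabilizer : IsStabilizerCode Q
  dim : Module.finrank ℂ Q = p ^ K
  dist : quantumDist Q = d

end

/-! Write H for the Hermitian dual of C. The form restricted to H has radical C ∩ H, so it factors
through a space of dimension e. As the norm maps onto the prime field, it is minus the pull-back of
the standard form along a surjection L : H → F^e (`IsHermForm.exists_surjective`). The graph S of L
is therefore self-orthogonal of length n + e. Let (x, y) ≠ 0 lie in its dual. If y = 0, then x ∈ C.
Otherwise x is orthogonal to ker L = C ∩ H, so x is in C + H; moreover x ≠ 0, and y adds at least 1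
to the weight (`exists_selfOrthogonal_extension`).

Writing vectors as a + w b with a, b over the prime field turns S into a symplectically isotropic
space of dimension 2(n - k) whose complement lies in the Hermitian dual of S. Its error operators,
with suitable phases, form a commutative group. A trace count gives the dimension of the fixed
space, and errors outside the complement map that space into its orthogonal complement
(`exists_isStabilizerCode`). Enlarging the isotropic space lowers K and only shrinks the complement,
which yields the second code. -/

/-! ### Concatenated vectors and Hamming weight -/

section Codes

variable {F : Type*} [Field F] {n : ℕ}

theorem hermInner_append (p : ℕ) {m : ℕ} (x x' : Fin n → F) (y y' : Fin m → F) :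
    hermInner p (Fin.append x y) (Fin.append x' y') = hermInner p x x' + hermInner p y y' := by
  simp [hermInner, Fin.sum_univ_add]

theorem hammingWt_append {m : ℕ} (x : Fin n → F) (y : Fin m → F) :
    hammingWt (Fin.append x y) = hammingWt x + hammingWt y := by
  classical
  simp only [hammingWt, Set.ncard_eq_toFinset_card', Set.toFinset_ofPred, Finset.card_filter,
    Fin.sum_univ_add, Fin.append_left, Fin.append_right]

theorem one_le_hammingWt {x : Fin n → F} (hx : x ≠ 0) : 1 ≤ hammingWt x := by
  obtain ⟨i, hi⟩ := Function.ne_iff.1 hx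
  exact (Set.ncard_pos (Set.toFinite _)).2 ⟨i, hi⟩

theorem codeWt_le {C : Submodule F (Fin n → F)} {x : Fin n → F} (hx : x ∈ C) (h0 : x ≠ 0) :
    codeWt C ≤ hammingWt x :=
  iInf₂_le x (⟨hx, h0⟩ : x ∈ {x | x ∈ C ∧ x ≠ 0})

end Codes

/-! ### Frobenius and norms in the field with p² elements -/

section FiniteField

theorem pow_pow_eq_self {p : ℕ} {F : Type*} [Field F] [Fintype F] (hF : Fintype.card F = p ^ 2) (x : F) : (x ^ p) ^ p = x := by
  rw [← pow_mul, ← sq, ← hF, FiniteField.pow_card]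

variable {p : ℕ} [Fact p.Prime] {F : Type*} [Field F] [Fintype F]

/-- A field with `p ^ 2` elements is not fixed pointwise by the Frobenius map. -/
theorem exists_pow_ne_self (hF : Fintype.card F = p ^ 2) : ∃ w : F, w ^ p ≠ w := by
  classical
  by_contra! h
  -- Otherwise X^p - X, of degree p, would have p² roots.
  have hp := (Fact.out : p.Prime).one_lt
  have hne := FiniteField.X_pow_card_sub_X_ne_zero F hp
  have hsub : (Finset.univ : Finset F).val ⊆ (Polynomial.X ^ p - Polynomial.X : Polynomial F).roots := by
    intro x _
    rw [Polynomial.mem_roots hne]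
    simp [h x]
  have h1 := Finset.card_le_card (s := Finset.univ)
    (t := (Polynomial.X ^ p - Polynomial.X : Polynomial F).roots.toFinset)
    (fun x hx => Multiset.mem_toFinset.2 (hsub hx))
  have h2 := Multiset.toFinset_card_le (Polynomial.X ^ p - Polynomial.X : Polynomial F).roots
  have h3 := Polynomial.card_roots' (Polynomial.X ^ p - Polynomial.X : Polynomial F)
  rw [FiniteField.X_pow_card_sub_X_natDegree_eq F hp] at h3
  rw [Finset.card_univ, hF] at h1
  nlinarith

/-- Every element of the prime field is a norm. -/
theorem exists_mul_pow_eq (hF : Fintype.card F = p ^ 2) {a : F} (ha : a ^ p = a) :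
    ∃ c : F, c * c ^ p = a := by
  have hp := (Fact.out : p.Prime).one_lt
  have : CharP F p := charP_of_card_eq_prime_pow hF
  let := ZMod.algebra F p
  have hbot := (Subfield.mem_bot_iff_pow_eq_self (F := F) p).2 ha
  obtain ⟨z, rfl⟩ := (mem_bot_iff_intCast p F).1 hbot
  obtain ⟨c, hc⟩ := FiniteField.norm_surjective (ZMod p) F (z : ZMod p)
  refine ⟨c, ?_⟩
  have h := FiniteField.algebraMap_norm_eq_pow (K := ZMod p) (x := c)
  rw [hc, Nat.card_eq_fintype_card, hF, Nat.card_zmod] at h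
  have : (p ^ 2 - 1) / (p - 1) = p + 1 := by
    rw [show p ^ 2 - 1 = (p + 1) * (p - 1) by simpa using Nat.sq_sub_sq p 1]
    exact Nat.mul_div_cancel _ (by omega)
  rw [this] at h
  rw [← pow_succ', ← h]
  simp

end FiniteField

/-! ### Diagonalization of Hermitian forms -/

section HermitianForm

variable {F : Type*} [Field F] {V : Type*} [AddCommGroup V] [Module F V]

/-- A Hermitian form with respect to the conjugation `a ↦ a ^ p`, linear in its first variable. -/
structure IsHermForm (p : ℕ) (B : V → V → F) : Prop where
  add_left : ∀ x y z, B (x + y) z = B x z + B y z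
  smul_left : ∀ (a : F) x y, B (a • x) y = a * B x y
  symm : ∀ x y, B y x = B x y ^ p

namespace IsHermForm

variable {p : ℕ} {B : V → V → F}

/-- The linear functional `x ↦ B x v`. -/
def left (hB : IsHermForm p B) (v : V) : V →ₗ[F] F where
  toFun x := B x v
  map_add' x y := hB.add_left x y v
  map_smul' a x := hB.smul_left a x v

theorem smul_right (hB : IsHermForm p B) (a : F) (x y : V) : B x (a • y) = a ^ p * B x y := by
  rw [hB.symm (a • y) x, hB.smul_left, mul_pow, ← hB.symm]

/-- The radical of a Hermitian form. -/
def rad (hB : IsHermForm p B) : Submodule F V where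
  carrier := {x | ∀ y, B x y = 0}
  zero_mem' y := (hB.left y).map_zero
  add_mem' {x x'} hx hx' y := by rw [hB.add_left, hx y, hx' y, add_zero]
  smul_mem' a x hx y := by rw [hB.smul_left, hx y, mul_zero]

variable [Fact p.Prime] [Fintype F]

theorem add_right (hB : IsHermForm p B) (hF : Fintype.card F = p ^ 2) (x y z : V) :
    B x (y + z) = B x y + B x z := by
  have : CharP F p := charP_of_card_eq_prime_pow hF
  rw [hB.symm (y + z) x, hB.add_left, add_pow_char, ← hB.symm, ← hB.symm]

/-- A Hermitian form without anisotropic vectors vanishes. -/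
theorem eq_zero_of_forall_self (hB : IsHermForm p B) (hF : Fintype.card F = p ^ 2)
    (h : ∀ v, B v v = 0) (x y : V) : B x y = 0 := by
  by_contra hxy
  -- Rescale x so that B x y = 1 and expand B at x + a y. Taking a = 1 gives 2 = 0, and then a = w
  -- gives w^p = w.
  have key (a : F) : a ^ p + a = 0 := by
    have hx : B ((B x y)⁻¹ • x) y = 1 := by rw [hB.smul_left, inv_mul_cancel₀ hxy]
    have := h ((B x y)⁻¹ • x + a • y)
    rw [hB.add_left, hB.add_right hF, hB.add_right hF, h, h, hB.smul_right, hx, hB.smul_left,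
      hB.symm _ y, hx] at this
    simpa using this
  obtain ⟨w, hw⟩ := exists_pow_ne_self hF
  have h2 := key 1
  rw [one_pow] at h2
  apply hw
  linear_combination key w - w * h2

/-- The Hermitian form obtained by splitting off a vector. -/
theorem split (hB : IsHermForm p B) (hF : Fintype.card F = p ^ 2) (v : V) {c : F}
    (hc : c ^ p = c) :
    IsHermForm p (fun x y => B x y + c * (B x v * B y v ^ p)) := by
  have : CharP F p := charP_of_card_eq_prime_pow hF
  refine ⟨fun x y z => ?_, fun a x y => ?_, fun x y => ?_⟩
  · simp only [hB.add_left]; ring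
  · simp only [hB.smul_left]; ring
  · simp only [add_pow_char, mul_pow, hc, ← hB.symm]; ring

/-- Every Hermitian form on a finite-dimensional space is the pull-back of minus the standard form
along a surjective linear map to a coordinate space. -/
theorem exists_surjective [FiniteDimensional F V] (hF : Fintype.card F = p ^ 2)
    (hB : IsHermForm p B) :
    ∃ (r : ℕ) (L : V →ₗ[F] (Fin r → F)), Function.Surjective L ∧
      ∀ x y, B x y = -hermInner p (L x) (L y) := by
  have : CharP F p := charP_of_card_eq_prime_pow hF
  have hp0 : p ≠ 0 := (Fact.out : p.Prime).ne_zero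
  have hneg : (-1 : F) ^ p = -1 := by
    have h := sub_pow_char (p := p) (0 : F) 1
    rwa [zero_sub, zero_pow hp0, one_pow, zero_sub] at h
  -- Induction on the rank of the form: splitting off an anisotropic vector puts it into the
  -- radical.
  induction hm : Module.finrank F V - Module.finrank F hB.rad using Nat.strong_induction_on
    generalizing B with
  | _ m ih =>
  by_cases h0 : ∀ v, B v v = 0
  · refine ⟨0, 0, fun x => ⟨0, Subsingleton.elim _ _⟩, fun x y => ?_⟩
    simp [hermInner, hB.eq_zero_of_forall_self hF h0]
  push Not at h0
  obtain ⟨v₀, hv₀⟩ := h0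
  obtain ⟨v, hv⟩ : ∃ v, B v v = -1 := by
    -- By Hermitian symmetry B v₀ v₀ lies in the prime field, so its negative inverse is a norm and
    -- v₀ can be rescaled.
    have h1 : (-(B v₀ v₀)⁻¹) ^ p = -(B v₀ v₀)⁻¹ := by
      rw [neg_pow, hneg, inv_pow, ← hB.symm]; ring
    obtain ⟨c, hc⟩ := exists_mul_pow_eq hF h1
    refine ⟨c • v₀, ?_⟩
    rw [hB.smul_left, hB.smul_right, ← mul_assoc, hc, neg_mul, inv_mul_cancel₀ hv₀]
  have hB' := hB.split hF v (one_pow p)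
  have hvrad : v ∈ hB'.rad := by
    intro y
    simp only [hv, ← hB.symm]; ring
  have hle : hB.rad ≤ hB'.rad := by
    intro x hx y
    simp only [hx _]; ring
  have hlt : hB.rad < hB'.rad := by
    refine lt_of_le_of_ne hle fun h => ?_
    rw [← h] at hvrad
    have := hvrad v
    rw [hv] at this
    simp at this
  have hfr := Submodule.finrank_lt_finrank_of_lt hlt
  have hfr' := Submodule.finrank_le hB'.rad
  obtain ⟨r, L, hL, hBL⟩ := ih _ (by omega) hB' rfl
  -- L v is orthogonal to the image of L, which is everything.
  have hLv : L v = 0 := by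
    funext i
    obtain ⟨y, hy⟩ := hL (Pi.single i 1)
    have h1 := hvrad y
    rw [hBL v y, hy, neg_eq_zero, hermInner, Finset.sum_eq_single i] at h1
    · simpa using h1
    · intro j _ hj
      simp [hj, hp0]
    · simp
  refine ⟨r + 1, LinearMap.pi (Fin.cons (hB.left v) fun i => LinearMap.proj i ∘ₗ L), ?_, ?_⟩
  · intro a
    obtain ⟨u, hu⟩ := hL (Fin.tail a)
    -- Adding a multiple of v changes only the new coordinate, because L v = 0 and B v v = -1.
    refine ⟨u + (B u v - a 0) • v, ?_⟩
    funext i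
    refine Fin.cases ?_ (fun i => ?_) i
    · simp [left, hB.add_left, hB.smul_left, hv]
    · simp [hLv, hu, Fin.tail]
  · intro x y
    have := hBL x y
    simp only [hermInner] at this ⊢
    rw [Fin.sum_univ_succ]
    simp only [LinearMap.pi_apply, Fin.cons_zero, Fin.cons_succ, LinearMap.comp_apply,
      LinearMap.proj_apply]
    change _ = -(B x v * B y v ^ p + _)
    linear_combination this

end IsHermForm

end HermitianForm

/-! ### Hermitian duals and the lengthened self-orthogonal code -/

section HermitianDual

variable {p : ℕ} [Fact p.Prime] {F : Type*} [Field F] [Fintype F] {n : ℕ}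

theorem isHermForm_hermInner (hF : Fintype.card F = p ^ 2) :
    IsHermForm p (hermInner p : (Fin n → F) → (Fin n → F) → F) := by
  have : CharP F p := charP_of_card_eq_prime_pow hF
  refine ⟨fun x y z => ?_, fun a x y => ?_, fun x y => ?_⟩
  · simp [hermInner, add_mul, Finset.sum_add_distrib]
  · simp [hermInner, mul_assoc, Finset.mul_sum]
  · simp [hermInner, sum_pow_char, mul_pow, pow_pow_eq_self hF, mul_comm]

/-- Pairing with x identifies the Hermitian dual with the annihilator of C. The identification is
only semilinear in x, so dimensions are compared by counting elements. -/
theorem finrank_hermDual (hF : Fintype.card F = p ^ 2) (C : Submodule F (Fin n → F)) :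
    Module.finrank F C + Module.finrank F (hermDual p C) = n := by
  classical
  have hB := isHermForm_hermInner (n := n) hF
  have hp0 : p ≠ 0 := (Fact.out : p.Prime).ne_zero
  have hsingle (i : Fin n) (x : Fin n → F) : hermInner p (Pi.single i 1) x = x i ^ p := by
    rw [hermInner, Finset.sum_eq_single i]
    · simp
    · intro j _ hj
      simp [hj]
    · simp
  let f : hermDual p C → C.dualAnnihilator := fun x => ⟨hB.left x, by
    rw [Submodule.mem_dualAnnihilator]
    intro c hc
    change hermInner p c x = 0
    rw [hB.symm x c, x.2 c hc, zero_pow hp0]⟩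
  have hf : Function.Bijective f := by
    constructor
    · intro x y hxy
      ext i
      have h := LinearMap.congr_fun (congrArg Subtype.val hxy) (Pi.single i 1)
      change hermInner p (Pi.single i 1) x.1 = hermInner p (Pi.single i 1) y.1 at h
      rw [hsingle, hsingle] at h
      rw [← pow_pow_eq_self hF (x.1 i), h, pow_pow_eq_self hF]
    · rintro ⟨g, hg⟩
      have hx : hB.left (fun i => g (Pi.single i 1) ^ p) = g := by
        refine LinearMap.pi_ext' fun i => LinearMap.ext_ring ?_
        simp only [LinearMap.comp_apply, LinearMap.single_apply]
        change hermInner p (Pi.single i 1) _ = _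
        rw [hsingle, pow_pow_eq_self hF]
      refine ⟨⟨fun i => g (Pi.single i 1) ^ p, fun c hc => ?_⟩, Subtype.ext hx⟩
      rw [hB.symm c]
      change hB.left (fun i => g (Pi.single i 1) ^ p) c ^ p = 0
      rw [hx, (Submodule.mem_dualAnnihilator g).1 hg c hc, zero_pow hp0]
  have hcard := Nat.card_congr (Equiv.ofBijective f hf)
  rw [Module.natCard_eq_pow_finrank (K := F) (V := hermDual p C),
    Module.natCard_eq_pow_finrank (K := F) (V := C.dualAnnihilator)] at hcard
  have := Nat.pow_right_injective (Finite.one_lt_card (α := F)) hcard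
  have h2 := Subspace.finrank_add_finrank_dualAnnihilator_eq C
  rw [Module.finrank_fin_fun] at h2
  omega

theorem hermDual_hermDual (hF : Fintype.card F = p ^ 2) (C : Submodule F (Fin n → F)) :
    hermDual p (hermDual p C) = C := by
  have hB := isHermForm_hermInner (n := n) hF
  have hp0 : p ≠ 0 := (Fact.out : p.Prime).ne_zero
  have hle : C ≤ hermDual p (hermDual p C) := by
    intro c hc x hx
    rw [hB.symm x c, hx c hc, zero_pow hp0]
  have h1 := finrank_hermDual hF C
  have h2 := finrank_hermDual hF (hermDual p C)
  exact (Submodule.eq_of_le_of_finrank_eq hle (by omega)).symm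

theorem hermDual_sup (hF : Fintype.card F = p ^ 2) (C D : Submodule F (Fin n → F)) :
    hermDual p (C ⊔ D) = hermDual p C ⊓ hermDual p D := by
  have hB := isHermForm_hermInner (n := n) hF
  refine le_antisymm (fun x hx => ⟨fun c hc => hx c (Submodule.mem_sup_left hc),
    fun c hc => hx c (Submodule.mem_sup_right hc)⟩) ?_
  rintro x ⟨h1, h2⟩ c hc
  obtain ⟨a, ha, b, hb, rfl⟩ := Submodule.mem_sup.1 hc
  rw [hB.add_right hF, h1 a ha, h2 b hb, add_zero]

/-- Hermitian construction X: the dual of a linear code `C` can be lengthened to a self-orthogonal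
code whose Hermitian dual has large minimum weight. -/
theorem exists_selfOrthogonal_extension (hF : Fintype.card F = p ^ 2)
    (C : Submodule F (Fin n → F)) {e : ℕ}
    (he : e + Module.finrank F (C ⊓ hermDual p C : Submodule F (Fin n → F)) =
      Module.finrank F (hermDual p C)) :
    ∃ S : Submodule F (Fin (n + e) → F), Module.finrank F S = Module.finrank F (hermDual p C) ∧
      S ≤ hermDual p S ∧
      ∀ x ∈ hermDual p S, x ≠ 0 →
        min (codeWt C) (codeWt (C ⊔ hermDual p C) + 1) ≤ hammingWt x := by
  classical
  have hp0 : p ≠ 0 := (Fact.out : p.Prime).ne_zero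
  have hB := isHermForm_hermInner (n := n) hF
  have hBH : IsHermForm p (fun x y : hermDual p C => hermInner p (x : Fin n → F) y) :=
    ⟨fun x y z => hB.add_left _ _ _, fun a x y => hB.smul_left _ _ _, fun x y => hB.symm _ _⟩
  obtain ⟨r, L, hL, hLB⟩ := hBH.exists_surjective hF
  -- As L is surjective, its kernel is the radical of the restricted form; this also forces r = e.
  have hker (x : hermDual p C) : L x = 0 ↔ (x : Fin n → F) ∈ C := by
    have hdd : (x : Fin n → F) ∈ hermDual p (hermDual p C) ↔ (x : Fin n → F) ∈ C := by
      rw [hermDual_hermDual hF C]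
    rw [← hdd]
    constructor
    · intro hx y hy
      rw [hLB x ⟨y, hy⟩, hx]
      simp [hermInner]
    · intro hx
      funext i
      obtain ⟨y, hy⟩ := hL (Pi.single i 1)
      have h1 := hx y y.2
      rw [hLB, hy, neg_eq_zero, hermInner, Finset.sum_eq_single i] at h1
      · simpa using h1
      · intro j _ hj
        simp [hj, hp0]
      · simp
  have hr : r = e := by
    have h1 := L.finrank_range_add_finrank_ker
    rw [LinearMap.range_eq_top.2 hL, finrank_top, Module.finrank_fin_fun] at h1
    have h2 : (LinearMap.ker L).map (hermDual p C).subtype = C ⊓ hermDual p C := by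
      ext x
      simp only [Submodule.mem_map, LinearMap.mem_ker, Submodule.mem_inf, Submodule.subtype_apply]
      constructor
      · rintro ⟨y, hy, rfl⟩
        exact ⟨(hker y).1 hy, y.2⟩
      · rintro ⟨h, h'⟩
        exact ⟨⟨x, h'⟩, (hker _).2 h, rfl⟩
    rw [← h2, Submodule.finrank_map_subtype_eq] at he
    omega
  subst hr
  let G : hermDual p C →ₗ[F] (Fin (n + r) → F) :=
    { toFun := fun x => Fin.append (x : Fin n → F) (L x)
      map_add' := fun x y => by
        funext i
        refine Fin.addCases (fun i => ?_) (fun i => ?_) i <;> simp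
      map_smul' := fun a x => by
        funext i
        refine Fin.addCases (fun i => ?_) (fun i => ?_) i <;> simp }
  have hG : Function.Injective G := by
    intro x y hxy
    ext i
    have := congrFun hxy (Fin.castAdd r i)
    simpa [G] using this
  refine ⟨LinearMap.range G, LinearMap.finrank_range_of_inj hG, ?_, ?_⟩
  · rintro _ ⟨x, rfl⟩ _ ⟨y, rfl⟩
    change hermInner p (Fin.append _ _) (Fin.append _ _) = 0
    rw [hermInner_append, hLB]
    ring
  · intro z hz hz0
    obtain ⟨x, y, rfl⟩ : ∃ x y, z = Fin.append (m := n) (n := r) x y :=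
      ⟨fun i => z (Fin.castAdd r i), fun i => z (Fin.natAdd n i), by
        rw [Fin.append_castAdd_natAdd]⟩
    have horth (h : hermDual p C) : hermInner p x h + hermInner p y (L h) = 0 := by
      rw [← hermInner_append]
      exact hz _ ⟨h, rfl⟩
    rw [hammingWt_append]
    by_cases hy : y = 0
    · subst hy
      have hx : x ∈ C := by
        rw [← hermDual_hermDual hF C]
        intro h hh
        simpa [hermInner] using horth ⟨h, hh⟩
      have hx0 : x ≠ 0 := by
        rintro rfl
        apply hz0
        funext i
        refine Fin.addCases (fun i => ?_) (fun i => ?_) i <;> simp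
      refine (min_le_left _ _).trans ((codeWt_le hx hx0).trans ?_)
      exact_mod_cast Nat.le_add_right _ _
    · have hx : x ∈ C ⊔ hermDual p C := by
        rw [← hermDual_hermDual hF (C ⊔ hermDual p C), hermDual_sup hF, hermDual_hermDual hF]
        rintro h ⟨hh, hC⟩
        have := horth ⟨h, hh⟩
        rw [(hker ⟨h, hh⟩).2 hC] at this
        simpa [hermInner, hp0] using this
      -- If x = 0, then y is orthogonal to the image of L, hence zero.
      have hx0 : x ≠ 0 := by
        rintro rfl
        apply hy
        funext i
        obtain ⟨h, hh⟩ := hL (Pi.single i 1)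
        have h1 := horth h
        rw [hh, hermInner, hermInner, Finset.sum_eq_single_of_mem i (Finset.mem_univ i)] at h1
        · simpa using h1
        · intro j _ hj
          simp [hj, hp0]
      refine (min_le_right _ _).trans ?_
      push_cast
      exact add_le_add (codeWt_le hx hx0) (by exact_mod_cast one_le_hammingWt hy)

end HermitianDual

/-! ### Common eigenvectors of commuting operators -/

section CommonEigenvector

/-- Finitely many commuting endomorphisms of a nonzero finite-dimensional vector space over an
algebraically closed field have a common eigenvector. -/
theorem Module.End.exists_common_eigenvector {k V ι : Type*} [Field k] [IsAlgClosed k]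
    [AddCommGroup V] [Module k V] [FiniteDimensional k V] [Nontrivial V] [Finite ι]
    (f : ι → Module.End k V) (hf : ∀ i j, Commute (f i) (f j)) :
    ∃ v : V, v ≠ 0 ∧ ∃ μ : ι → k, ∀ i, f i v = μ i • v := by
  classical
  have := Fintype.ofFinite ι
  -- W stays invariant under the whole family, so the next operator has an eigenvalue on W; its
  -- eigenspace there is again invariant by commutation.
  have key (s : Finset ι) : ∃ W : Submodule k V, W ≠ ⊥ ∧ (∀ i, ∀ w ∈ W, f i w ∈ W) ∧
      ∀ i ∈ s, ∃ μ : k, ∀ w ∈ W, f i w = μ • w := by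
    induction s using Finset.induction_on with
    | empty => exact ⟨⊤, top_ne_bot, fun _ _ _ => Submodule.mem_top, by simp⟩
    | insert i s _ ih =>
      obtain ⟨W, hW, hinv, hs⟩ := ih
      have := (Submodule.nontrivial_iff_ne_bot).2 hW
      obtain ⟨μ, hμ⟩ := Module.End.exists_eigenvalue ((f i).restrict (hinv i))
      obtain ⟨w, hw⟩ := hμ.exists_hasEigenvector
      refine ⟨W ⊓ (f i).eigenspace μ, ?_, ?_, ?_⟩
      · refine (Submodule.ne_bot_iff _).2 ⟨w, ⟨w.2, ?_⟩, fun h => hw.2 (Subtype.ext h)⟩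
        exact Module.End.mem_eigenspace_iff.2 (congrArg Subtype.val hw.apply_eq_smul)
      · rintro j x ⟨hx, hx'⟩
        have hx' : f i x = μ • x := Module.End.mem_eigenspace_iff.1 hx'
        refine ⟨hinv j x hx, Module.End.mem_eigenspace_iff.2 ?_⟩
        have := LinearMap.congr_fun (hf i j) x
        rw [Module.End.mul_apply, Module.End.mul_apply, hx', map_smul] at this
        exact this
      · intro j hj
        rcases Finset.mem_insert.1 hj with rfl | hj
        · exact ⟨μ, fun x hx => Module.End.mem_eigenspace_iff.1 hx.2⟩
        · obtain ⟨ν, hν⟩ := hs j hj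
          exact ⟨ν, fun x hx => hν x hx.1⟩
  obtain ⟨W, hW, -, hμ⟩ := key Finset.univ
  obtain ⟨v, hv, hv0⟩ := (Submodule.ne_bot_iff _).1 hW
  choose μ hμ using fun i => hμ i (Finset.mem_univ i)
  exact ⟨v, hv0, μ, fun i => hμ i v hv⟩

end CommonEigenvector

/-! ### Symplectic form and isotropic subspaces -/

section Symplectic

/-- The symplectic form on pairs of vectors that governs the commutation of error operators. -/
def sympForm (p N : ℕ) :
    LinearMap.BilinForm (ZMod p) ((Fin N → ZMod p) × (Fin N → ZMod p)) :=
  LinearMap.mk₂ (ZMod p) (fun v w => v.2 ⬝ᵥ w.1 - w.2 ⬝ᵥ v.1)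
    (fun v v' w => by simp only [Prod.fst_add, Prod.snd_add, add_dotProduct, dotProduct_add]; ring)
    (fun c v w => by
      simp only [Prod.smul_fst, Prod.smul_snd, smul_dotProduct, dotProduct_smul, smul_sub])
    (fun v w w' => by simp only [Prod.fst_add, Prod.snd_add, add_dotProduct, dotProduct_add]; ring)
    (fun c v w => by
      simp only [Prod.smul_fst, Prod.smul_snd, smul_dotProduct, dotProduct_smul, smul_sub])

variable {p N : ℕ}

theorem sympForm_apply (v w : (Fin N → ZMod p) × (Fin N → ZMod p)) :
    sympForm p N v w = v.2 ⬝ᵥ w.1 - w.2 ⬝ᵥ v.1 := rfl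

theorem isAlt_sympForm : (sympForm p N).IsAlt := fun _ => sub_self _

theorem exists_sympForm_ne_zero {v : (Fin N → ZMod p) × (Fin N → ZMod p)} (hv : v ≠ 0) :
    ∃ w, sympForm p N v w ≠ 0 := by
  by_contra! h
  apply hv
  ext i
  · simpa [sympForm_apply] using h (0, Pi.single i 1)
  · simpa [sympForm_apply] using h (Pi.single i 1, 0)

variable [Fact p.Prime]

/-- Isotropic subspaces extend to isotropic subspaces of every dimension up to `N`. -/
theorem exists_isotropic_extension (S : Submodule (ZMod p) ((Fin N → ZMod p) × (Fin N → ZMod p)))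
    (hS : S ≤ (sympForm p N).orthogonal S) {m : ℕ} (hm : Module.finrank (ZMod p) S ≤ m)
    (hmN : m ≤ N) :
    ∃ T, S ≤ T ∧ T ≤ (sympForm p N).orthogonal T ∧ Module.finrank (ZMod p) T = m := by
  induction m, hm using Nat.le_induction with
  | base => exact ⟨S, le_rfl, hS, rfl⟩
  | succ m hm ih =>
    obtain ⟨T, hST, hT, hTm⟩ := ih (by omega)
    have hdim := LinearMap.BilinForm.finrank_add_finrank_orthogonal' (B := sympForm p N) T
    rw [Module.finrank_prod, Module.finrank_fin_fun] at hdim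
    -- The complement has dimension at least 2N - m, which exceeds m because m < N.
    have hnot : ¬ (sympForm p N).orthogonal T ≤ T := by
      intro h
      have := Submodule.finrank_mono h
      omega
    obtain ⟨v, hv, hvT⟩ := SetLike.not_le_iff_exists.1 hnot
    refine ⟨T ⊔ Submodule.span (ZMod p) {v}, hST.trans le_sup_left, ?_, ?_⟩
    · have hvv (x) (hx : x ∈ T ⊔ Submodule.span (ZMod p) {v}) (y)
          (hy : y ∈ T ⊔ Submodule.span (ZMod p) {v}) : sympForm p N x y = 0 := by
        obtain ⟨a, ha, b, hb, rfl⟩ := Submodule.mem_sup.1 hx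
        obtain ⟨a', ha', b', hb', rfl⟩ := Submodule.mem_sup.1 hy
        obtain ⟨c, rfl⟩ := Submodule.mem_span_singleton.1 hb
        obtain ⟨c', rfl⟩ := Submodule.mem_span_singleton.1 hb'
        have h1 : sympForm p N a a' = 0 := hT ha' a ha
        have h2 : sympForm p N a v = 0 := hv a ha
        have h3 : sympForm p N v a' = 0 := isAlt_sympForm.isRefl _ _ (hv a' ha')
        have h4 : sympForm p N v v = 0 := isAlt_sympForm v
        simp [h1, h2, h3, h4]
      exact fun y hy x hx => hvv x hx y hy
    · have hv0 : v ≠ 0 := by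
        rintro rfl
        exact hvT T.zero_mem
      have h1 := Submodule.finrank_sup_add_finrank_inf_eq T (Submodule.span (ZMod p) {v})
      rw [finrank_span_singleton hv0, (Submodule.disjoint_span_singleton' hv0).2 hvT |>.eq_bot,
        finrank_bot] at h1
      omega

end Symplectic

/-! ### Algebra of error operators -/

section ErrorOp

variable {p N : ℕ} [NeZero p]

theorem errorOp_apply (a b : Fin N → ZMod p) (ψ : QuditSpace p N) (x : Fin N → ZMod p) :
    errorOp a b ψ x = ZMod.stdAddChar (b ⬝ᵥ (x - a)) * ψ (x - a) := rfl

theorem errorOp_mul (v w : (Fin N → ZMod p) × (Fin N → ZMod p)) :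
    errorOp v.1 v.2 * errorOp w.1 w.2 =
      ZMod.stdAddChar (v.2 ⬝ᵥ w.1) • errorOp (v + w).1 (v + w).2 := by
  refine LinearMap.ext fun ψ => ?_
  ext x
  simp only [Module.End.mul_apply, LinearMap.smul_apply, PiLp.smul_apply, smul_eq_mul,
    errorOp_apply]
  rw [← mul_assoc, ← mul_assoc, ← AddChar.map_add_eq_mul, ← AddChar.map_add_eq_mul,
    Prod.fst_add, Prod.snd_add, sub_sub]
  congr 2
  simp only [add_dotProduct, dotProduct_sub, dotProduct_add]
  ring

theorem errorOp_zero : errorOp (0 : Fin N → ZMod p) 0 = 1 := by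
  refine LinearMap.ext fun ψ => ?_
  ext x
  simp [errorOp_apply]

theorem errorOp_mul_comm (v w : (Fin N → ZMod p) × (Fin N → ZMod p)) :
    errorOp v.1 v.2 * errorOp w.1 w.2 =
      ZMod.stdAddChar (sympForm p N v w) • (errorOp w.1 w.2 * errorOp v.1 v.2) := by
  rw [errorOp_mul, errorOp_mul, smul_smul, ← AddChar.map_add_eq_mul, sympForm_apply,
    sub_add_cancel, add_comm w v]

theorem inner_errorOp (a b : Fin N → ZMod p) (φ ψ : QuditSpace p N) :
    inner ℂ (errorOp a b φ) (errorOp a b ψ) = inner ℂ φ ψ := by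
  simp only [PiLp.inner_apply, errorOp_apply]
  refine Fintype.sum_equiv (Equiv.subRight a) _ _ fun x => ?_
  have h : (starRingEnd ℂ) (ZMod.stdAddChar (b ⬝ᵥ (x - a))) *
      ZMod.stdAddChar (b ⬝ᵥ (x - a)) = 1 := by
    rw [Complex.conj_mul', AddChar.norm_apply]; simp
  simp only [RCLike.inner_apply, map_mul, Equiv.subRight_apply]
  linear_combination ψ (x - a) * (starRingEnd ℂ) (φ (x - a)) * h

theorem isUnit_errorOp (v : (Fin N → ZMod p) × (Fin N → ZMod p)) :
    IsUnit (errorOp v.1 v.2) := by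
  refine LinearMap.isUnit_iff_ker_eq_bot _ |>.2 (LinearMap.ker_eq_bot'.2 fun ψ hψ => ?_)
  rw [← inner_self_eq_zero (𝕜 := ℂ), ← inner_errorOp v.1 v.2, hψ, inner_zero_left]

/-- Conjugation by an error that does not commute with this one preserves the trace, yet multiplies
it by a nontrivial root of unity. -/
theorem trace_errorOp {v : (Fin N → ZMod p) × (Fin N → ZMod p)} (hv : v ≠ 0) :
    LinearMap.trace ℂ (QuditSpace p N) (errorOp v.1 v.2) = 0 := by
  obtain ⟨w, hw⟩ := exists_sympForm_ne_zero hv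
  obtain ⟨u, hu⟩ := isUnit_errorOp w
  have h := congrArg (fun T => LinearMap.trace ℂ (QuditSpace p N) (T * ↑u⁻¹))
    (errorOp_mul_comm v w)
  simp only [← hu, Units.mul_inv_cancel_right, smul_mul_assoc, map_smul, smul_eq_mul] at h
  rw [mul_assoc, LinearMap.trace_mul_comm, Units.inv_mul_cancel_right] at h
  by_contra h0
  apply hw
  have h1 : ZMod.stdAddChar (sympForm p N v w) = 1 := mul_right_cancel₀ h0 (by rw [one_mul, ← h])
  rw [← AddChar.map_zero_eq_one (ZMod.stdAddChar (N := p))] at h1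
  exact ZMod.injective_stdAddChar h1

end ErrorOp

/-! ### Stabilizer codes from isotropic subspaces -/

section StabilizerCode

variable {p N : ℕ} [Fact p.Prime]

/-- The representation of an isotropic subspace by error operators with suitable phases. -/
theorem exists_errorOp_representation
    (S : Submodule (ZMod p) ((Fin N → ZMod p) × (Fin N → ZMod p)))
    (hS : S ≤ (sympForm p N).orthogonal S) :
    ∃ (ρ : Representation ℂ (Multiplicative S) (QuditSpace p N)) (c : S → ℂ),
      ∀ v : S, ρ (Multiplicative.ofAdd v) = c v • errorOp v.1.1 v.1.2 ∧ ‖c v‖ = 1 := by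
  -- The eigenvalues on a common eigenvector obey the same cocycle relation as the operators, so
  -- dividing by them gives a true representation, for p = 2 as well.
  obtain ⟨ψ, hψ, μ, hμ⟩ := Module.End.exists_common_eigenvector
    (fun v : S => (errorOp v.1.1 v.1.2 : Module.End ℂ (QuditSpace p N))) (fun v w => by
      have h : sympForm p N v w = 0 := hS w.2 v v.2
      have := errorOp_mul_comm v.1 w.1
      rwa [h, AddChar.map_zero_eq_one, one_smul] at this)
  have hinj := smul_left_injective ℂ hψ
  have hnorm (v : S) : ‖μ v‖ = 1 := by
    have h1 := inner_errorOp v.1.1 v.1.2 ψ ψ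
    rw [hμ, inner_self_eq_norm_sq_to_K, inner_self_eq_norm_sq_to_K, norm_smul] at h1
    have h2 : (‖μ v‖ * ‖ψ‖) ^ 2 = ‖ψ‖ ^ 2 := by exact_mod_cast h1
    have h3 := (sq_eq_sq₀ (by positivity) (by positivity)).1 h2
    exact mul_right_cancel₀ (norm_ne_zero_iff.2 hψ) (by rw [h3, one_mul])
  have hμ0 (v : S) : μ v ≠ 0 := by
    rw [← norm_ne_zero_iff, hnorm]; exact one_ne_zero
  have hzero : μ 0 = 1 := by
    apply hinj
    have := hμ 0
    simp only [Submodule.coe_zero, Prod.fst_zero, Prod.snd_zero, errorOp_zero,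
      Module.End.one_apply] at this
    simp only [← this, one_smul]
  have hadd (v w : S) : μ v * μ w = ZMod.stdAddChar (v.1.2 ⬝ᵥ w.1.1) * μ (v + w) := by
    apply hinj
    have h := LinearMap.congr_fun (errorOp_mul v.1 w.1) ψ
    have h' := hμ (v + w)
    rw [Submodule.coe_add] at h'
    rw [Module.End.mul_apply, hμ, map_smul, hμ, LinearMap.smul_apply, h', smul_smul,
      smul_smul] at h
    simp only [← h, mul_comm]
  refine ⟨{ toFun := fun v => (μ v.toAdd)⁻¹ • errorOp v.toAdd.1.1 v.toAdd.1.2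
            map_one' := ?_
            map_mul' := fun v w => ?_ }, fun v => (μ v)⁻¹, fun v => ⟨rfl, ?_⟩⟩
  · simp [hzero, errorOp_zero]
  · rw [smul_mul_smul_comm, errorOp_mul, smul_smul, ← mul_inv, hadd, toAdd_mul, Submodule.coe_add,
      mul_inv, mul_right_comm, inv_mul_cancel₀, one_mul]
    intro h
    have := AddChar.norm_apply (ZMod.stdAddChar (N := p)) (v.toAdd.1.2 ⬝ᵥ w.toAdd.1.1)
    rw [h, norm_zero] at this
    exact zero_ne_one this
  · rw [norm_inv, hnorm, inv_one]

/-- An isotropic subspace of dimension `N - K` is the stabilizer of a code of dimension `p ^ K`,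
which annihilates every error outside of the symplectic complement. -/
theorem exists_isStabilizerCode
    (S : Submodule (ZMod p) ((Fin N → ZMod p) × (Fin N → ZMod p)))
    (hS : S ≤ (sympForm p N).orthogonal S) {K : ℕ}
    (hK : Module.finrank (ZMod p) S + K = N) :
    ∃ Q : Submodule ℂ (QuditSpace p N), IsStabilizerCode Q ∧ Module.finrank ℂ Q = p ^ K ∧
      ∀ v ∉ (sympForm p N).orthogonal S, ∀ φ ∈ Q, ∀ ψ ∈ Q,
        inner ℂ φ (errorOp v.1 v.2 ψ) = 0 := by
  classical
  obtain ⟨ρ, c, hρ⟩ := exists_errorOp_representation S hS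
  have hp0 : (p : ℂ) ≠ 0 := by exact_mod_cast (Fact.out : p.Prime).ne_zero
  refine ⟨ρ.invariants, ⟨(MonoidHom.toHomUnits ρ).range, ?_, ?_, fun ψ => ?_⟩, ?_, ?_⟩
  · rintro _ ⟨v, rfl⟩
    exact ⟨c v.toAdd, v.toAdd.1.1, v.toAdd.1.2, (hρ v.toAdd).1⟩
  · rintro _ ⟨v, rfl⟩ _ ⟨w, rfl⟩
    rw [← map_mul, mul_comm, map_mul]
  · constructor
    · rintro h _ ⟨v, rfl⟩
      exact h v
    · intro h v
      exact h _ ⟨v, rfl⟩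
  · have := Fintype.ofFinite (Multiplicative S)
    have hcard : Nat.card (Multiplicative S) = p ^ Module.finrank (ZMod p) S := by
      rw [Nat.card_congr Multiplicative.toAdd, Module.natCard_eq_pow_finrank (K := ZMod p) (V := S),
        Nat.card_zmod]
    have hcard0 : (Nat.card (Multiplicative S) : ℂ) ≠ 0 := by
      rw [hcard]
      push_cast
      exact pow_ne_zero _ hp0
    let := invertibleOfNonzero hcard0
    -- The invariants have dimension equal to the average of the character, to which only the
    -- identity contributes.
    have h := Representation.card_inv_mul_sum_char_eq_finrank ρ
    rw [Finset.sum_eq_single_of_mem 1 (Finset.mem_univ 1), Representation.char_one,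
      finrank_euclideanSpace, Fintype.card_pi_const, ZMod.card, inv_mul_eq_iff_eq_mul₀ hcard0,
      hcard] at h
    · have h' : p ^ N = p ^ Module.finrank (ZMod p) S * Module.finrank ℂ ρ.invariants := by
        exact_mod_cast h
      have hN : p ^ N = p ^ Module.finrank (ZMod p) S * p ^ K := by rw [← pow_add, hK]
      exact Nat.eq_of_mul_eq_mul_left (pow_pos (Fact.out : p.Prime).pos _) (h'.symm.trans hN)
    · intro v _ hv
      have hv0 : (v.toAdd : S).1 ≠ 0 := fun h =>
        hv (Multiplicative.toAdd.injective (Subtype.ext h))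
      change LinearMap.trace ℂ _ (ρ (Multiplicative.ofAdd v.toAdd)) = 0
      rw [(hρ v.toAdd).1, map_smul, trace_errorOp hv0, smul_zero]
  · intro v hv φ hφ ψ hψ
    obtain ⟨s, hs, hsv⟩ : ∃ s ∈ S, sympForm p N s v ≠ 0 := by
      by_contra! h
      exact hv h
    obtain ⟨hs1, hs2⟩ := hρ ⟨s, hs⟩
    set γ := c ⟨s, hs⟩
    have hfix (χ) (hχ : χ ∈ ρ.invariants) : γ • errorOp s.1 s.2 χ = χ := by
      rw [← LinearMap.smul_apply, ← hs1]
      exact hχ _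
    -- Moving the stabilizer element s past the error multiplies the inner product by a root of
    -- unity different from 1.
    have h1 : inner ℂ φ (errorOp v.1 v.2 ψ) =
        ZMod.stdAddChar (sympForm p N s v) * inner ℂ φ (errorOp v.1 v.2 ψ) := by
      have hcomm := LinearMap.congr_fun (errorOp_mul_comm s v) ψ
      simp only [Module.End.mul_apply, LinearMap.smul_apply] at hcomm
      have hγ : (starRingEnd ℂ) γ * γ = 1 := by rw [Complex.conj_mul', hs2]; simp
      calc inner ℂ φ (errorOp v.1 v.2 ψ)
          = (starRingEnd ℂ) γ * γ * inner ℂ (errorOp s.1 s.2 φ)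
              (errorOp s.1 s.2 (errorOp v.1 v.2 ψ)) := by rw [hγ, one_mul, inner_errorOp]
        _ = inner ℂ (γ • errorOp s.1 s.2 φ) (γ • errorOp s.1 s.2 (errorOp v.1 v.2 ψ)) := by
              rw [inner_smul_left, inner_smul_right, mul_assoc]
        _ = _ := by
              rw [hfix φ hφ, hcomm, smul_comm, ← map_smul (errorOp v.1 v.2), hfix ψ hψ,
                inner_smul_right]
    by_contra h0
    apply hsv
    have h2 : ZMod.stdAddChar (sympForm p N s v) = 1 :=
      mul_right_cancel₀ h0 (by rw [one_mul, ← h1])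
    rw [← AddChar.map_zero_eq_one (ZMod.stdAddChar (N := p))] at h2
    exact ZMod.injective_stdAddChar h2

/-- The stabilizer construction with the bound on the minimum distance. -/
theorem exists_isQuantumCode
    (S : Submodule (ZMod p) ((Fin N → ZMod p) × (Fin N → ZMod p)))
    (hS : S ≤ (sympForm p N).orthogonal S) {K : ℕ}
    (hK : Module.finrank (ZMod p) S + K = N) {δ : ℕ∞}
    (hδ : ∀ v ∈ (sympForm p N).orthogonal S, v ≠ 0 → δ ≤ errorWt v.1 v.2) :
    ∃ (d : ℕ∞) (Q : Submodule ℂ (QuditSpace p N)), IsQuantumCode Q K d ∧ δ ≤ d := by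
  obtain ⟨Q, hQ, hdim, horth⟩ := exists_isStabilizerCode S hS hK
  refine ⟨quantumDist Q, Q, ⟨hQ, hdim, rfl⟩, ?_⟩
  unfold quantumDist
  split_ifs
  · refine le_iInf₂ fun v hv => hδ v ?_ hv.1
    obtain ⟨-, φ, hφ, ψ, hψ, h⟩ := hv
    by_contra hvS
    exact h (horth v hvS φ hφ ψ hψ)
  · refine le_iInf₂ fun v hv => hδ v ?_ ?_
    · by_contra hvS
      exact hv ⟨0, fun φ hφ ψ hψ => by rw [horth v hvS φ hφ ψ hψ, zero_mul]⟩
    · rintro rfl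
      exact hv ⟨1, fun φ _ ψ _ => by simp [errorOp_zero]⟩

end StabilizerCode

/-! ### From Hermitian to symplectic self-orthogonality -/

section HermitianConstruction

theorem algebraMap_pow_eq_self {p : ℕ} [Fact p.Prime] {F : Type*} [Field F] [Algebra (ZMod p) F]
    (a : ZMod p) :
    algebraMap (ZMod p) F a ^ p = algebraMap (ZMod p) F a := by
  rw [← map_pow, ZMod.pow_card]

theorem algebraMap_add_mul_eq_zero {p : ℕ} [Fact p.Prime] {F : Type*} [Field F]
    [Algebra (ZMod p) F] {w : F} (hw : w ^ p ≠ w) {a b : ZMod p}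
    (h : algebraMap (ZMod p) F a + w * algebraMap (ZMod p) F b = 0) : a = 0 ∧ b = 0 := by
  have hb : b = 0 := by
    by_contra hb
    apply hw
    have hb' : algebraMap (ZMod p) F b ≠ 0 := by simpa using hb
    have : w = algebraMap (ZMod p) F (-a / b) := by
      rw [map_div₀, map_neg, eq_div_iff hb']
      linear_combination h
    rw [this, algebraMap_pow_eq_self]
  subst hb
  simpa using h

variable {p : ℕ} [Fact p.Prime] {F : Type*} [Field F] [Fintype F] [Algebra (ZMod p) F] {N : ℕ}

/-- The map sending the pair `(a, b)` to the vector `a + w b`. -/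
def pairToVec (p N : ℕ) {F : Type*} [Field F] [Algebra (ZMod p) F] (w : F) :
    ((Fin N → ZMod p) × (Fin N → ZMod p)) →ₗ[ZMod p] (Fin N → F) where
  toFun v i := algebraMap (ZMod p) F (v.1 i) + w * algebraMap (ZMod p) F (v.2 i)
  map_add' v v' := by
    funext i
    simp only [Prod.fst_add, Prod.snd_add, Pi.add_apply, map_add]
    ring
  map_smul' c v := by
    funext i
    simp only [Prod.smul_fst, Prod.smul_snd, Pi.smul_apply, smul_eq_mul, map_mul,
      RingHom.id_apply]
    rw [Algebra.smul_def]
    ring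

theorem pairToVec_bijective (hF : Fintype.card F = p ^ 2) {w : F} (hw : w ^ p ≠ w) :
    Function.Bijective (pairToVec p N w) := by
  classical
  rw [Fintype.bijective_iff_injective_and_card]
  constructor
  · rw [← LinearMap.ker_eq_bot, LinearMap.ker_eq_bot']
    intro v hv
    have h i := algebraMap_add_mul_eq_zero hw (congrFun hv i)
    exact Prod.ext (funext fun i => (h i).1) (funext fun i => (h i).2)
  · rw [Fintype.card_prod, Fintype.card_pi_const, Fintype.card_pi_const, ZMod.card, hF]
    ring

theorem errorWt_eq_hammingWt {p N : ℕ} [Fact p.Prime] {F : Type*} [Field F]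
    [Algebra (ZMod p) F] {w : F} (hw : w ^ p ≠ w)
    (v : (Fin N → ZMod p) × (Fin N → ZMod p)) :
    errorWt v.1 v.2 = hammingWt (pairToVec p N w v) := by
  unfold errorWt hammingWt
  congr 1
  ext i
  simp only [Set.mem_ofPred_eq, ← not_and_or]
  refine not_congr ⟨fun h => ?_, algebraMap_add_mul_eq_zero hw⟩
  simp [pairToVec, h.1, h.2]

/-- The symplectic form is the skew part of the Hermitian inner product. -/
theorem hermInner_pairToVec_sub (hF : Fintype.card F = p ^ 2) (w : F)
    (v v' : (Fin N → ZMod p) × (Fin N → ZMod p)) :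
    hermInner p (pairToVec p N w v) (pairToVec p N w v') -
        hermInner p (pairToVec p N w v') (pairToVec p N w v) =
      (w - w ^ p) * algebraMap (ZMod p) F (sympForm p N v v') := by
  have : CharP F p := charP_of_card_eq_prime_pow hF
  simp only [hermInner, sympForm_apply, dotProduct, ← Finset.sum_sub_distrib, map_sum,
    Finset.mul_sum]
  refine Finset.sum_congr rfl fun i _ => ?_
  simp only [pairToVec, LinearMap.coe_mk, AddHom.coe_mk, add_pow_char, mul_pow,
    algebraMap_pow_eq_self, map_sub, map_mul]
  ring

/-- A Hermitian self-orthogonal linear code gives rise to quantum codes. -/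
theorem exists_isQuantumCode_of_le_hermDual (hF : Fintype.card F = p ^ 2)
    (S : Submodule F (Fin N → F)) (hS : S ≤ hermDual p S) {K : ℕ}
    (hK : 2 * Module.finrank F S + K ≤ N) {δ : ℕ∞}
    (hδ : ∀ x ∈ hermDual p S, x ≠ 0 → δ ≤ hammingWt x) :
    ∃ (d : ℕ∞) (Q : Submodule ℂ (QuditSpace p N)), IsQuantumCode Q K d ∧ δ ≤ d := by
  have hp := (Fact.out : p.Prime)
  obtain ⟨w, hw⟩ := exists_pow_ne_self hF
  have hB := isHermForm_hermInner (n := N) hF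
  have hbij := pairToVec_bijective (N := N) hF hw
  set T := (S.restrictScalars (ZMod p)).comap (pairToVec p N w)
  have hmem (v) : v ∈ T ↔ pairToVec p N w v ∈ S := Iff.rfl
  have hT : T ≤ (sympForm p N).orthogonal T := by
    intro v hv u hu
    have h := hermInner_pairToVec_sub hF w u v
    rw [hS hu _ hv, hS hv _ hu, sub_zero, eq_comm] at h
    simpa [sub_eq_zero, hw.symm] using h
  have horth (v) (hv : v ∈ (sympForm p N).orthogonal T) : pairToVec p N w v ∈ hermDual p S := by
    intro c hc
    by_contra h0
    apply hw
    -- The multiple of c, available since S is linear over F, is scaled to have inner product w with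
    -- the vector of v; symplectic orthogonality would then give w = w^p.
    obtain ⟨u, hu⟩ := hbij.2 ((w * (hermInner p c (pairToVec p N w v))⁻¹) • c)
    have h1 := hermInner_pairToVec_sub hF w u v
    have huT : u ∈ T := (hmem u).2 (hu ▸ S.smul_mem _ hc)
    have h2 : sympForm p N u v = 0 := hv u huT
    have hne : hermInner p c (pairToVec p N w v) ≠ 0 := by
      intro h
      apply h0
      rw [hB.symm, h, zero_pow hp.ne_zero]
    rw [h2, map_zero, mul_zero, hu, hB.symm _ (pairToVec p N w v), hB.smul_left, mul_assoc,
      inv_mul_cancel₀ hne, mul_one] at h1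
    linear_combination -h1
  have hdim : Module.finrank (ZMod p) T = 2 * Module.finrank F S := by
    have hcard := Nat.card_congr ((Equiv.ofBijective _ hbij).subtypeEquiv hmem)
    have hcard' : Nat.card T = Nat.card S := hcard
    rw [Module.natCard_eq_pow_finrank (K := ZMod p) (V := T),
      Module.natCard_eq_pow_finrank (K := F) (V := S), Nat.card_zmod, Nat.card_eq_fintype_card,
      hF, ← pow_mul] at hcard'
    exact Nat.pow_right_injective hp.two_le hcard'
  -- K may be smaller than N - 2 dim S; enlarging T makes up the difference and keeps the weight
  -- bound.
  obtain ⟨U, hTU, hU, hUdim⟩ := exists_isotropic_extension T hT (m := N - K) (by omega) (by omega)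
  refine exists_isQuantumCode U hU (by omega) fun v hv hv0 => ?_
  rw [errorWt_eq_hammingWt hw]
  refine hδ _ (horth v (LinearMap.BilinForm.orthogonal_le hTU hv)) fun h => hv0 (hbij.1 ?_)
  rw [h, map_zero]

end HermitianConstruction

theorem theorem3 (p : ℕ) [Fact p.Prime] {F : Type*} [Field F] [Fintype F]
    (hF : Fintype.card F = p ^ 2) (n k : ℕ) (C : Submodule F (Fin n → F))
    (hk : Module.finrank F C = k) :
    ∃ e : ℕ, (e : ℤ) = n - k - Module.finrank F (C ⊓ hermDual p C : Submodule F (Fin n → F)) ∧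
      (∃ K : ℕ, (K : ℤ) = 2 * k - n + e ∧
        ∃ (d : ℕ∞) (Q : Submodule ℂ (QuditSpace p (n + e))),
          IsQuantumCode Q K d ∧ min (codeWt C) (codeWt (C ⊔ hermDual p C) + 1) ≤ d) ∧
      (∀ K : ℕ, (K : ℤ) = 2 * k - n →
        ∃ (d : ℕ∞) (Q : Submodule ℂ (QuditSpace p (n + e))),
          IsQuantumCode Q K d ∧ min (codeWt C) (codeWt (C ⊔ hermDual p C) + 1) ≤ d) := by
  have : CharP F p := charP_of_card_eq_prime_pow hF
  let := ZMod.algebra F p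
  have hdual := finrank_hermDual hF C
  have hle₁ := Submodule.finrank_mono (inf_le_left : C ⊓ hermDual p C ≤ C)
  have hle₂ := Submodule.finrank_mono (inf_le_right : C ⊓ hermDual p C ≤ hermDual p C)
  obtain ⟨e, he⟩ := Nat.exists_eq_add_of_le' hle₂
  obtain ⟨S, hSdim, hS, hwt⟩ := exists_selfOrthogonal_extension hF C he.symm
  -- The subtraction does not truncate: 2k + e - n = k - dim(C ∩ H) ≥ 0.
  refine ⟨e, by omega, ⟨2 * k + e - n, by omega, ?_⟩, fun K hK => ?_⟩
  · exact exists_isQuantumCode_of_le_hermDual hF S hS (by omega) hwt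
  · exact exists_isQuantumCode_of_le_hermDual hF S hS (by omega) hwt
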